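/- **Definitions.** Let $f:X\to Y$ be a map between metric spaces. For a non-isolated point $x\in X$ put $$D_x^-f=\liminf_{z\to x,\,z\ne x}\frac{d(f(z),f(x))}{d(z,x)},\qquad D_x^+f=\limsup_{z\to x,\,z\ne x}\frac{d(f(z),f(x))}{d(z,x)}$$ (isolated points impose no condition in any bound below). The map $f$ is a *quasi-isometry* if it is a homeomorphism and there are constants $0<\alpha\le\beta<\infty$ with $D_x^-f\ge\alpha$ and $D_x^+f\le\beta$ for all $x\in X$; it is a *local quasi-isometry* if for every $x\in X$ there are open neighbourhoods $V$ of $x$ and $W$ of $f(x)$ such that $f$ restricts to a quasi-isometry $V\to W$. Paths are continuous. The length $\ell(p)$ of a path $p:[a,b]\to Y$ is the supremum of $\sum_i d(p(t_i),p(t_{i+1}))$ over all partitions of $[a,b]$; for $q:[a,b)\to Y$, $\ell(q)=\lim_{t\to b^-}\ell(q|_{[a,t]})$. A path is *rectifiable* if its length is finite. $Y$ is *locally $\mathcal R$-contractible* if every $y_0\in Y$ has an open neighbourhood $U$ with a continuous map $H:U\times[0,1]\to U$ such that $H(y_0,t)=y_0$ for all $t$, $H(y,0)=y_0$ and $H(y,1)=y$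 for all $y\in U$, and each path $t\mapsto H(y,t)$, $y\in U$, is rectifiable. Let $p:[0,1]\to Y$ be a path. A *partial lift* of $p$ is a continuous $q:[0,b)\to X$, $0<b\le1$, with $f\circ q=p$ on $[0,b)$. - $f$ has the *continuation property* for $p$ if for every partial lift $q:[0,b)\to X$ there is a sequence $t_n\in[0,b)$ with $t_n\to b$ such that $(q(t_n))$ converges in $X$. - $f$ has the *bounded path-lifting property* for $p$ if for every partial lift $q$ there is $\alpha>0$ with $D_x^-f\ge\alpha$ for all $x\in\operatorname{Im}q$. - A *weight* is a nondecreasing function $\omega:[0,\infty)\to(0,\infty)$ with $\int_0^\infty dt/\omega(t)=\infty$. $f$ has the *bounded path-lifting property for $p$ with respect to $\omega$* if for every partial lift $q$ there are $x_0\in X$ and $\alpha>0$ with $D_x^-f\cdot\omega(d(x,x_0))\ge\alpha$ for all $x\in\operatorname{Im}q$. A *covering projection* is a surjection $f:X\to Y$ such that every point of $Y$ has an open neighbourhood $U$ for which $f^{-1}(U)$ is a disjoint union of open sets each mapped homeomorphically onto $U$ by $f$. **Theorem.** Let $f:X\to Y$ be a local quasi-isometry between complete metric spaces, with $X$ non-empty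 and $Y$ path-connected and locally $\mathcal R$-contractible. Then the following are equivalent: 1. $f$ is a covering projection. 2. $f$ has the continuation property for every rectifiable path $p:[0,1]\to Y$. 3. For every $a<b$ and every path $q:[a,b)\to X$, $\ell(q)<\infty$ whenever $\ell(f\circ q)<\infty$. 4. $f$ has the bounded path-lifting property for every rectifiable path $p:[0,1]\to Y$. 5. There is a weight $\omega$ such that $f$ has the bounded path-lifting property with respect to $\omega$ for every rectifiable path $p:[0,1]\to Y$. If in addition $X$ is path-connected, and either $Y$ is simply connected or $\pi_1(X)$ and $\pi_1(Y)$ are isomorphic finite groups, then these conditions are also equivalent to each of the following: 6. $f$ is a homeomorphism. 7. $f$ is a proper map, that is, $f$ is continuous and $f^{-1}(K)$ is compact for every compact $K\subset Y$. 8. For every compact $K\subset Y$ there is $\alpha_K>0$ such that $D_x^-f\ge\alpha_K$ for every $x\in f^{-1}(K)$. -/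

import Mathlib

open Set Filter Topology MeasureTheory
open scoped ENNReal

/-- The lower scalar derivative `D_x^- f`, as an extended nonnegative number. At an isolated point of
`X` the lower limit is over the empty punctured neighbourhood and equals `∞`, so that isolated points
impose no condition in lower bounds for `D_x^- f`. -/
noncomputable def lowerScalarDeriv {X Y : Type*} [MetricSpace X] [MetricSpace Y]
    (f : X → Y) (x : X) : ℝ≥0∞ :=
  liminf (fun z => edist (f z) (f x) / edist z x) (𝓝[≠] x)

/-- The upper scalar derivative `D_x^+ f`. At an isolated point it equals `0`, so that isolated points
impose no condition in upper bounds for `D_x^+ f`. -/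
noncomputable def upperScalarDeriv {X Y : Type*} [MetricSpace X] [MetricSpace Y]
    (f : X → Y) (x : X) : ℝ≥0∞ :=
  limsup (fun z => edist (f z) (f x) / edist z x) (𝓝[≠] x)

/-- A quasi-isometry: a homeomorphism with `α ≤ inf D^- f` and `sup D^+ f ≤ β`, for some
`0 < α ≤ β < ∞`. -/
def IsDiniQuasiIsometry {X Y : Type*} [MetricSpace X] [MetricSpace Y] (f : X → Y) : Prop :=
  IsHomeomorph f ∧ ∃ α β : ℝ, 0 < α ∧ α ≤ β ∧
    ENNReal.ofReal α ≤ (⨅ x, lowerScalarDeriv f x) ∧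
    (⨆ x, upperScalarDeriv f x) ≤ ENNReal.ofReal β

/-- A local quasi-isometry: every `x` has an open neighbourhood `V`, and `f x` an open
neighbourhood `W`, such that `f` restricts to a quasi-isometry from `V` to `W`. -/
def IsLocalDiniQuasiIsometry {X Y : Type*} [MetricSpace X] [MetricSpace Y] (f : X → Y) : Prop :=
  ∀ x : X, ∃ (V : Set X) (W : Set Y) (h : MapsTo f V W),
    IsOpen V ∧ x ∈ V ∧ IsOpen W ∧ f x ∈ W ∧ IsDiniQuasiIsometry (h.restrict f V W)

/-- The length of the restriction of `p` to `[a, b]`: the supremum over all partitions. -/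
noncomputable def pathLength {Y : Type*} [MetricSpace Y] (p : ℝ → Y) (a b : ℝ) : ℝ≥0∞ :=
  eVariationOn p (Icc a b)

/-- The length of the restriction of `q` to `[a, b)`: the limit of the lengths on `[a, t]`
as `t → b⁻`, which by monotonicity is their supremum (see `tendsto_pathLength`). -/
noncomputable def pathLengthIco {Y : Type*} [MetricSpace Y] (q : ℝ → Y) (a b : ℝ) : ℝ≥0∞ :=
  ⨆ t ∈ Ico a b, pathLength q a t

theorem tendsto_pathLength {Y : Type*} [MetricSpace Y] (q : ℝ → Y) {a b : ℝ} (hab : a < b) :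
    Tendsto (fun t => pathLength q a t) (𝓝[<] b) (𝓝 (pathLengthIco q a b)) := by
  have hmono : Monotone (fun t => pathLength q a t) := fun s t hst =>
    eVariationOn.mono q (Icc_subset_Icc_right hst)
  have h := hmono.tendsto_nhdsLT b
  have heq : sSup ((fun t => pathLength q a t) '' Iio b) = pathLengthIco q a b := by
    rw [sSup_image]
    apply le_antisymm
    · refine iSup₂_le fun t ht => ?_
      refine le_trans (hmono (le_max_left t a)) ?_
      exact le_iSup₂_of_le (f := fun t (_ : t ∈ Ico a b) => pathLength q a t) (max t a)
        ⟨le_max_right _ _, max_lt ht hab⟩ le_rfl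
    · refine iSup₂_le fun t ht => ?_
      exact le_iSup₂_of_le (f := fun t (_ : t ∈ Iio b) => pathLength q a t) t ht.2 le_rfl
  rwa [heq] at h

/-- `p` restricts to a rectifiable (continuous) path on `[0, 1]`; its values elsewhere
are irrelevant. -/
def IsRectifiablePath {Y : Type*} [MetricSpace Y] (p : ℝ → Y) : Prop :=
  ContinuousOn p (Icc 0 1) ∧ pathLength p 0 1 < ∞

/-- `U` contracts within itself to `y₀` by a homotopy `H : U × [0, 1] → U` that fixes `y₀` and all of
whose paths `t ↦ H (y, t)` are rectifiable. -/
def IsRectifiablyContractibleTo {Y : Type*} [MetricSpace Y] (U : Set Y) (y₀ : Y) : Prop :=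
  ∃ H : Y × ℝ → Y, ContinuousOn H (U ×ˢ Icc 0 1) ∧ MapsTo H (U ×ˢ Icc 0 1) U ∧
    (∀ t ∈ Icc (0 : ℝ) 1, H (y₀, t) = y₀) ∧
    (∀ y ∈ U, H (y, 0) = y₀ ∧ H (y, 1) = y) ∧
    ∀ y ∈ U, IsRectifiablePath fun t => H (y, t)

/-- Local `ℛ`-contractibility, where `ℛ` is the family of rectifiable paths. -/
def IsLocallyRectifiablyContractible (Y : Type*) [MetricSpace Y] : Prop :=
  ∀ y₀ : Y, ∃ U : Set Y, IsOpen U ∧ y₀ ∈ U ∧ IsRectifiablyContractibleTo U y₀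

/-- A covering projection: a surjection such that every point of the base has an evenly covered
open neighbourhood. -/
def IsCoveringProjection {X Y : Type*} [MetricSpace X] [MetricSpace Y] (f : X → Y) : Prop :=
  IsCoveringMap f ∧ Function.Surjective f

/-- `q` restricts to a continuous path on `[0, b)` with `f ∘ q = p` over `[0, b)`. -/
def IsPartialLift {X Y : Type*} [MetricSpace X] [MetricSpace Y] (f : X → Y) (p : ℝ → Y)
    (b : ℝ) (q : ℝ → X) : Prop :=
  ContinuousOn q (Ico 0 b) ∧ ∀ t ∈ Ico 0 b, f (q t) = p t

/-- The continuation property of `f` for the path `p` on `[0, 1]`. -/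
def HasContinuationProperty {X Y : Type*} [MetricSpace X] [MetricSpace Y] (f : X → Y)
    (p : ℝ → Y) : Prop :=
  ∀ b ∈ Ioc (0 : ℝ) 1, ∀ q : ℝ → X, IsPartialLift f p b q →
    ∃ t : ℕ → ℝ, (∀ n, t n ∈ Ico 0 b) ∧ Tendsto t atTop (𝓝 b) ∧
      ∃ z : X, Tendsto (fun n => q (t n)) atTop (𝓝 z)

/-- The bounded path-lifting property of `f` for the path `p` on `[0, 1]`. -/
def HasBoundedPathLifting {X Y : Type*} [MetricSpace X] [MetricSpace Y] (f : X → Y)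
    (p : ℝ → Y) : Prop :=
  ∀ b ∈ Ioc (0 : ℝ) 1, ∀ q : ℝ → X, IsPartialLift f p b q →
    ∃ α : ℝ, 0 < α ∧ ENNReal.ofReal α ≤ ⨅ x ∈ q '' Ico 0 b, lowerScalarDeriv f x

/-- A weight: a nondecreasing `ω : [0, ∞) → (0, ∞)` with `∫₀^∞ dt / ω(t) = ∞`. The values of `ω` on
negative numbers are irrelevant. -/
def IsWeight (ω : ℝ → ℝ) : Prop :=
  MonotoneOn ω (Ici 0) ∧ (∀ t ∈ Ici (0 : ℝ), 0 < ω t) ∧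
    ∫⁻ t in Ici (0 : ℝ), ENNReal.ofReal (1 / ω t) = ∞

/-- The bounded path-lifting property of `f` for the path `p` on `[0, 1]`, with respect to the
weight `ω`. -/
def HasWeightedBoundedPathLifting {X Y : Type*} [MetricSpace X] [MetricSpace Y] (f : X → Y)
    (p : ℝ → Y) (ω : ℝ → ℝ) : Prop :=
  ∀ b ∈ Ioc (0 : ℝ) 1, ∀ q : ℝ → X, IsPartialLift f p b q →
    ∃ (x₀ : X) (α : ℝ), 0 < α ∧ ENNReal.ofReal α ≤
      ⨅ x ∈ q '' Ico 0 b, lowerScalarDeriv f x * ENNReal.ofReal (ω (dist x x₀))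

/-- Every continuous path `q : [a, b) → X` whose image path `f ∘ q` has finite length
has itself finite length. -/
def LiftsFiniteLength {X Y : Type*} [MetricSpace X] [MetricSpace Y] (f : X → Y) : Prop :=
  ∀ (a b : ℝ) (q : ℝ → X), a < b → ContinuousOn q (Ico a b) →
    pathLengthIco (f ∘ q) a b < ∞ → pathLengthIco q a b < ∞

/-- A proper map: continuous, and preimages of compact sets are compact. -/
def IsCompactProper {X Y : Type*} [MetricSpace X] [MetricSpace Y] (f : X → Y) : Prop :=
  Continuous f ∧ ∀ K : Set Y, IsCompact K → IsCompact (f ⁻¹' K)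

/-- For every compact `K` there is `α_K > 0` with `D_x^- f ≥ α_K` for all `x ∈ f⁻¹(K)`. -/
def LowerBoundedOverCompacts {X Y : Type*} [MetricSpace X] [MetricSpace Y] (f : X → Y) : Prop :=
  ∀ K : Set Y, IsCompact K → ∃ α : ℝ, 0 < α ∧
    ∀ x ∈ f ⁻¹' K, ENNReal.ofReal α ≤ lowerScalarDeriv f x

open scoped unitInterval

/-! ### Length estimates along lifts, and weights -/

section Estimates

variable {X Y : Type*} [MetricSpace X] [MetricSpace Y] {f : X → Y}

/-! If `D⁻f > c` along a path `q`, then `c · ℓ(q) ≤ ℓ(f ∘ q)`. So a lower bound on `D⁻f` along a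
partial lift of a rectifiable path gives the lift finite length, and completeness of `X` makes it
converge: this is the continuation property. With a weight, moving from distance `k` to `k + 1` from
`x₀` costs length at least about `α / ω(k + 1)` in `Y`. These costs have infinite sum, so the lift
stays bounded, `ω` is bounded along it, and the unweighted case applies.

The continuation property lets every rectifiable path be lifted. Lifting the contracting paths of a
neighbourhood `U` of `y₀` trivialises `f` over `U`: a point over `U` is carried to the fibre over
`y₀`, and back by the reversed lift.

Conversely, over a covering, a lift whose image path converges itself converges. Its closure is then
compact, and the local bounds on `D⁻f` become uniform along it.

With the assumptions on fundamental groups, `f_*` is surjective on `π₁`, which forces a covering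
with path-connected total space to be injective. A homeomorphism is proper, properness bounds `D⁻f`
below over compact sets, and such a bound over the image of a path is bounded path-lifting. -/

theorem eventually_mul_edist_le_of_lt_lowerScalarDeriv {x : X} {c : ℝ≥0∞}
    (h : c < lowerScalarDeriv f x) :
    ∀ᶠ z in 𝓝 x, c * edist z x ≤ edist (f z) (f x) := by
  have h1 := eventually_lt_of_lt_liminf h
  rw [eventually_nhdsWithin_iff] at h1
  filter_upwards [h1] with z hz
  rcases eq_or_ne z x with rfl | hzx
  · simp
  · exact ENNReal.mul_le_of_le_div (hz hzx).le

/-- Continuous induction: the triangle inequality and additivity of variation propagate the estimate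
from `[a, s]` to `[a, t]`. The local hypothesis at the supremum `T` is used on its left to reach `T`
and on its right to pass it. -/
theorem mul_edist_le_eVariationOn_Icc {g : ℝ → X} {h : ℝ → Y} {c : ℝ≥0∞} {a b : ℝ} (hab : a ≤ b)
    (hloc : ∀ t ∈ Icc a b, ∀ᶠ s in 𝓝[Icc a b] t, c * edist (g s) (g t) ≤ edist (h s) (h t)) :
    c * edist (g a) (g b) ≤ eVariationOn h (Icc a b) := by
  set S : Set ℝ := {t | t ∈ Icc a b ∧ c * edist (g a) (g t) ≤ eVariationOn h (Icc a t)} with hS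
  have ha : a ∈ S := ⟨⟨le_rfl, hab⟩, by simp⟩
  have hbdd : BddAbove S := ⟨b, fun t ht => ht.1.2⟩
  have step : ∀ s t, s ∈ S → s ≤ t → t ≤ b → c * edist (g s) (g t) ≤ edist (h s) (h t) → t ∈ S := by
    intro s t hs hst htb hle
    refine ⟨⟨hs.1.1.trans hst, htb⟩, ?_⟩
    calc c * edist (g a) (g t) ≤ c * (edist (g a) (g s) + edist (g s) (g t)) := by
          gcongr; exact edist_triangle _ _ _
      _ = c * edist (g a) (g s) + c * edist (g s) (g t) := mul_add _ _ _
      _ ≤ eVariationOn h (Icc a s) + eVariationOn h (Icc s t) := by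
          gcongr
          · exact hs.2
          · exact hle.trans (eVariationOn.edist_le _ ⟨le_rfl, hst⟩ ⟨hst, le_rfl⟩)
      _ = eVariationOn h (Icc a t) := by
          have := eVariationOn.Icc_add_Icc h (s := univ) hs.1.1 hst (mem_univ s)
          simpa using this
  set T := sSup S with hT
  have hTab : T ∈ Icc a b := ⟨le_csSup hbdd ha, csSup_le ⟨a, ha⟩ fun t ht => ht.1.2⟩
  have hnear := hloc T hTab
  rw [eventually_nhdsWithin_iff, Metric.eventually_nhds_iff] at hnear
  obtain ⟨ε, hε, hnear⟩ := hnear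
  have hTS : T ∈ S := by
    obtain ⟨s, hs, hsT⟩ := exists_lt_of_lt_csSup ⟨a, ha⟩ (sub_lt_self T hε)
    have hsT' : s ≤ T := le_csSup hbdd hs
    refine step s T hs hsT' hTab.2 (hnear ?_ hs.1)
    rw [Real.dist_eq, abs_lt]; constructor <;> linarith
  have hTb : T = b := by
    by_contra hne
    have hlt : T < b := lt_of_le_of_ne hTab.2 hne
    have hm : T < min (T + ε / 2) b := lt_min (by linarith) hlt
    have hmS : min (T + ε / 2) b ∈ S := by
      refine step T _ hTS hm.le (min_le_right _ _) ?_
      rw [edist_comm (g T), edist_comm (h T)]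
      refine hnear ?_ ⟨hTab.1.trans hm.le, min_le_right _ _⟩
      have := min_le_left (T + ε / 2) b
      rw [Real.dist_eq, abs_lt]; constructor <;> linarith
    exact absurd (le_csSup hbdd hmS) (not_le.2 hm)
  exact hTb ▸ hTS.2

theorem mul_edist_le_eVariationOn_comp {q : ℝ → X} {a b : ℝ} {c : ℝ≥0∞} (hab : a ≤ b)
    (hq : ContinuousOn q (Icc a b)) (hc : ∀ t ∈ Icc a b, c < lowerScalarDeriv f (q t)) :
    c * edist (q a) (q b) ≤ eVariationOn (f ∘ q) (Icc a b) :=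
  mul_edist_le_eVariationOn_Icc hab fun t ht =>
    (hq t ht).eventually (eventually_mul_edist_le_of_lt_lowerScalarDeriv (hc t ht))

theorem mul_eVariationOn_le_eVariationOn_comp {q : ℝ → X} {s : Set ℝ} [hs : s.OrdConnected]
    {c : ℝ≥0∞} (hq : ContinuousOn q s) (hc : ∀ t ∈ s, c < lowerScalarDeriv f (q t)) :
    c * eVariationOn q s ≤ eVariationOn (f ∘ q) s := by
  unfold eVariationOn
  rw [ENNReal.mul_iSup]
  refine iSup_le fun ⟨n, u, hu, hus⟩ => ?_
  refine le_trans ?_ (eVariationOn.mono (f ∘ q) (hs.out (hus 0) (hus n)))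
  rw [← eVariationOn.sum' _ hu, Finset.mul_sum]
  refine Finset.sum_le_sum fun i _ => ?_
  have hsub : Icc (u i) (u (i + 1)) ⊆ s := hs.out (hus i) (hus (i + 1))
  rw [edist_comm]
  exact mul_edist_le_eVariationOn_comp (hu i.le_succ) (hq.mono hsub) fun t ht => hc t (hsub ht)

theorem eVariationOn_lt_top_of_lowerScalarDeriv_bound {q : ℝ → X} {s : Set ℝ} [hs : s.OrdConnected]
    {α : ℝ} (hα : 0 < α) (hq : ContinuousOn q s)
    (hb : ∀ t ∈ s, ENNReal.ofReal α ≤ lowerScalarDeriv f (q t))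
    (hfin : eVariationOn (f ∘ q) s < ∞) : eVariationOn q s < ∞ := by
  -- A lower limit controls nearby quotients only by constants strictly below it, hence the loss of
  -- a factor 2.
  have hlt : ENNReal.ofReal (α / 2) < ENNReal.ofReal α :=
    (ENNReal.ofReal_lt_ofReal_iff hα).2 (by linarith)
  have h := (mul_eVariationOn_le_eVariationOn_comp (c := ENNReal.ofReal (α / 2)) hq
    fun t ht => hlt.trans_le (hb t ht)).trans_lt hfin
  exact ENNReal.lt_top_of_mul_ne_top_right h.ne (ENNReal.ofReal_pos.2 (by linarith)).ne'

theorem pathLengthIco_eq_eVariationOn (q : ℝ → X) (a b : ℝ) :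
    pathLengthIco q a b = eVariationOn q (Ico a b) := by
  apply le_antisymm
  · exact iSup₂_le fun t ht => eVariationOn.mono q (Icc_subset_Ico_right ht.2)
  · refine iSup_le fun ⟨n, u, hu, hus⟩ => ?_
    refine le_iSup₂_of_le (f := fun t (_ : t ∈ Ico a b) => pathLength q a t) (u n) (hus n) ?_
    exact eVariationOn.sum_le_of_monotoneOn_Iic (hu.monotoneOn _)
      fun i hi => ⟨(hus i).1, hu hi⟩

theorem exists_tendsto_of_eVariationOn_lt_top [CompleteSpace X] {q : ℝ → X} {a b : ℝ}
    (h : eVariationOn q (Ico a b) < ∞) : ∃ z, Tendsto q (𝓝[Ico a b] b) (𝓝 z) := by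
  have h' : BoundedVariationOn q (Ico a b) := h.ne
  obtain ⟨z, hz⟩ := h'.exists_tendsto_left b
  refine ⟨z, ?_⟩
  rwa [inter_eq_left.2 fun t ht => ht.2] at hz

/-- By monotonicity `1 / ω ≤ 1 / ω(k)` on `[k, k + 1)`, so the series dominates the divergent
integral; dropping `m` finite terms changes nothing. -/
theorem tsum_ofReal_one_div_eq_top_of_isWeight {ω : ℝ → ℝ} (hω : IsWeight ω) (m : ℕ) :
    ∑' k : ℕ, ENNReal.ofReal (1 / ω ((k + m : ℕ) : ℝ)) = ∞ := by
  obtain ⟨hmono, hpos, hint⟩ := hω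
  have hunion : Ici (0 : ℝ) ⊆ ⋃ k : ℕ, Ico (k : ℝ) (k + 1) := fun t ht =>
    mem_iUnion.2 ⟨⌊t⌋₊, Nat.floor_le ht, Nat.lt_floor_add_one t⟩
  have h0 : ∑' k : ℕ, ENNReal.ofReal (1 / ω (k : ℝ)) = ∞ := by
    rw [← top_le_iff, ← hint]
    refine (lintegral_mono_set hunion).trans ((lintegral_iUnion_le _ _).trans ?_)
    refine ENNReal.tsum_le_tsum fun k => ?_
    calc ∫⁻ t in Ico (k : ℝ) (k + 1), ENNReal.ofReal (1 / ω t)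
        ≤ ∫⁻ _ in Ico (k : ℝ) (k + 1), ENNReal.ofReal (1 / ω k) := by
          refine setLIntegral_mono' measurableSet_Ico fun t ht => ENNReal.ofReal_le_ofReal ?_
          have hk : (0 : ℝ) ≤ k := k.cast_nonneg
          exact one_div_le_one_div_of_le (hpos _ hk) (hmono hk (hk.trans ht.1) ht.1)
      _ = ENNReal.ofReal (1 / ω k) := by simp
  have hsplit := (ENNReal.summable (f := fun k : ℕ =>
    ENNReal.ofReal (1 / ω ((k + m : ℕ) : ℝ)))).sum_add_tsum_nat_add'
    (f := fun k : ℕ => ENNReal.ofReal (1 / ω (k : ℝ)))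
  rw [h0, ENNReal.add_eq_top] at hsplit
  refine hsplit.resolve_left ?_
  exact (ENNReal.sum_lt_top.2 fun _ _ => ENNReal.ofReal_lt_top).ne

/-- Isolates a stretch of time on which the distance climbs from `u` to `v` without exceeding `v`,
so that there the weight is at most its value at `v`. -/
theorem exists_crossing {r : ℝ → ℝ} {a t u v : ℝ} (hat : a ≤ t) (hr : ContinuousOn r (Icc a t))
    (huv : u ≤ v) (hau : r a ≤ u) (hv : v ≤ r t) :
    ∃ s s', a ≤ s ∧ s ≤ s' ∧ s' ≤ t ∧ r s = u ∧ r s' = v ∧ ∀ x ∈ Icc s s', r x ≤ v := by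
  -- `s'` is the first time at which the level `v` is reached
  have hivt := intermediate_value_Icc hat hr
  have hcl : IsClosed (Icc a t ∩ r ⁻¹' {v}) := hr.preimage_isClosed_of_isClosed isClosed_Icc
    isClosed_singleton
  have hcpt : IsCompact (Icc a t ∩ r ⁻¹' {v}) := isCompact_Icc.of_isClosed_subset hcl
    inter_subset_left
  obtain ⟨x, hx, hxv⟩ := hivt ⟨hau.trans huv, hv⟩
  obtain ⟨s', ⟨hs'1, hs'2⟩, hs'min⟩ := hcpt.exists_isLeast ⟨x, hx, hxv⟩
  have hle : ∀ x ∈ Icc a s', r x ≤ v := by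
    intro x hx
    by_contra! hlt
    obtain ⟨y, hy, hyv⟩ := intermediate_value_Icc hx.1
      (hr.mono (Icc_subset_Icc_right (hx.2.trans hs'1.2))) ⟨hau.trans huv, hlt.le⟩
    have h1 : s' ≤ y := hs'min ⟨⟨hy.1, hy.2.trans (hx.2.trans hs'1.2)⟩, hyv⟩
    have h2 : x = y := le_antisymm (hx.2.trans h1) hy.2
    rw [h2, hyv] at hlt
    exact lt_irrefl _ hlt
  obtain ⟨s, hs, hsu⟩ := intermediate_value_Icc hs'1.1 (hr.mono (Icc_subset_Icc_right hs'1.2))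
    ⟨hau, huv.trans (mem_singleton_iff.1 hs'2).ge⟩
  exact ⟨s, s', hs.1, hs.2, hs'1.2, hsu, hs'2, fun x hx => hle x ⟨hs.1.trans hx.1, hx.2⟩⟩

/-- A path whose image has finite length, and along which `D^- f` is bounded below with respect to
a weight, has bounded image. -/
theorem exists_dist_le_of_isWeight {ω : ℝ → ℝ} (hω : IsWeight ω) {q : ℝ → X} {a b : ℝ}
    {x₀ : X} {α : ℝ} (hα : 0 < α) (hq : ContinuousOn q (Ico a b))
    (hb : ∀ t ∈ Ico a b,
      ENNReal.ofReal α ≤ lowerScalarDeriv f (q t) * ENNReal.ofReal (ω (dist (q t) x₀)))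
    (hfin : eVariationOn (f ∘ q) (Ico a b) < ∞) :
    ∃ R, 0 ≤ R ∧ ∀ t ∈ Ico a b, dist (q t) x₀ ≤ R := by
  by_contra! hcon
  obtain ⟨N, hN⟩ := exists_nat_ge (dist (q a) x₀)
  -- Cost of climbing from distance `N + k` to `N + k + 1`: the weight is evaluated at the upper
  -- end, where it is largest, and `α / 2` makes the bound on `D⁻f` strict.
  set c : ℕ → ℝ≥0∞ := fun k => ENNReal.ofReal (α / 2) *
    ENNReal.ofReal (1 / ω ((k + (N + 1) : ℕ) : ℝ)) with hcdef
  have hcont : ContinuousOn (fun t => dist (q t) x₀) (Ico a b) := fun t ht =>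
    (hq t ht).dist continuousWithinAt_const
  have key : ∀ n : ℕ, ∀ t ∈ Ico a b, ((N + n : ℕ) : ℝ) ≤ dist (q t) x₀ →
      ∑ k ∈ Finset.range n, c k ≤ eVariationOn (f ∘ q) (Icc a t) := by
    intro n
    induction n with
    | zero => intro t _ _; simp
    | succ n ih =>
      intro t ht hr
      obtain ⟨s, s', has, hss', hs't, hrs, hrs', hle⟩ := exists_crossing ht.1
        (hcont.mono (Icc_subset_Ico_right ht.2)) (u := ((N + n : ℕ) : ℝ))
        (v := ((N + (n + 1) : ℕ) : ℝ)) (by push_cast; linarith)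
        (hN.trans (by push_cast; linarith [(n.cast_nonneg : (0 : ℝ) ≤ n)])) hr
      have hsub : Icc s s' ⊆ Ico a b := fun x hx => ⟨has.trans hx.1, (hx.2.trans hs't).trans_lt ht.2⟩
      have hωpos : 0 < ω ((n + (N + 1) : ℕ) : ℝ) := hω.2.1 _ (mem_Ici.2 (Nat.cast_nonneg _))
      have hlow : ∀ x ∈ Icc s s', c n < lowerScalarDeriv f (q x) := by
        intro x hx
        have h1 := hb x (hsub hx)
        have h2 : ω (dist (q x) x₀) ≤ ω ((n + (N + 1) : ℕ) : ℝ) := by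
          refine hω.1 dist_nonneg (mem_Ici.2 (Nat.cast_nonneg _)) ((hle x hx).trans_eq ?_)
          push_cast; ring
        have h3 : ENNReal.ofReal α ≤
            lowerScalarDeriv f (q x) * ENNReal.ofReal (ω ((n + (N + 1) : ℕ) : ℝ)) :=
          h1.trans (by gcongr)
        refine lt_of_lt_of_le ?_ (ENNReal.div_le_of_le_mul h3)
        change ENNReal.ofReal (α / 2) * ENNReal.ofReal (1 / ω ((n + (N + 1) : ℕ) : ℝ)) < _
        rw [← ENNReal.ofReal_div_of_pos hωpos, ← ENNReal.ofReal_mul (by linarith),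
          ENNReal.ofReal_lt_ofReal_iff (by positivity), mul_one_div]
        gcongr
        linarith
      have h4 := mul_edist_le_eVariationOn_comp hss' (hq.mono hsub) hlow
      have h5 : (1 : ℝ≥0∞) ≤ edist (q s) (q s') := by
        have h6 : (1 : ℝ) ≤ dist (q s) (q s') := by
          have h7 := dist_triangle (q s') (q s) x₀
          rw [hrs, hrs', dist_comm (q s')] at h7
          push_cast at h7
          linarith
        rw [edist_dist, ← ENNReal.ofReal_one]
        exact ENNReal.ofReal_le_ofReal h6
      have h8 := ih s ⟨has, hss'.trans_lt (hs't.trans_lt ht.2)⟩ hrs.ge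
      rw [Finset.sum_range_succ]
      calc ∑ k ∈ Finset.range n, c k + c n
          ≤ eVariationOn (f ∘ q) (Icc a s) + eVariationOn (f ∘ q) (Icc s s') := by
            gcongr
            exact (by simpa using mul_le_mul_right h5 (c n) : c n ≤ c n * _).trans h4
        _ = eVariationOn (f ∘ q) (Icc a s') := by
            simpa using eVariationOn.Icc_add_Icc (f ∘ q) (s := univ) has hss' (mem_univ s)
        _ ≤ _ := eVariationOn.mono _ (Icc_subset_Icc_right hs't)
  have hsum : ∑' k, c k ≤ eVariationOn (f ∘ q) (Ico a b) := by
    refine ENNReal.tsum_le_of_sum_range_le fun n => ?_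
    obtain ⟨t, ht, htn⟩ := hcon ((N + n : ℕ) : ℝ) (Nat.cast_nonneg _)
    exact (key n t ht htn.le).trans (eVariationOn.mono _ (Icc_subset_Ico_right ht.2))
  rw [hcdef, ENNReal.tsum_mul_left, tsum_ofReal_one_div_eq_top_of_isWeight hω,
    ENNReal.mul_top (ENNReal.ofReal_pos.2 (by linarith)).ne'] at hsum
  exact absurd hsum (not_le.2 hfin)

theorem eVariationOn_lt_top_of_isWeight {ω : ℝ → ℝ} (hω : IsWeight ω) {q : ℝ → X} {a b : ℝ}
    {x₀ : X} {α : ℝ} (hα : 0 < α) (hq : ContinuousOn q (Ico a b))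
    (hb : ∀ t ∈ Ico a b,
      ENNReal.ofReal α ≤ lowerScalarDeriv f (q t) * ENNReal.ofReal (ω (dist (q t) x₀)))
    (hfin : eVariationOn (f ∘ q) (Ico a b) < ∞) : eVariationOn q (Ico a b) < ∞ := by
  obtain ⟨R, hR, hle⟩ := exists_dist_le_of_isWeight hω hα hq hb hfin
  have hωpos := hω.2.1 R hR
  refine eVariationOn_lt_top_of_lowerScalarDeriv_bound (f := f) (div_pos hα hωpos) hq
    (fun t ht => ?_) hfin
  rw [ENNReal.ofReal_div_of_pos hωpos]
  refine ENNReal.div_le_of_le_mul ((hb t ht).trans ?_)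
  gcongr
  exact hω.1 dist_nonneg hR (hle t ht)

theorem isWeight_one : IsWeight fun _ => 1 := by
  refine ⟨fun _ _ _ _ _ => le_rfl, fun _ _ => one_pos, ?_⟩
  simp

end Estimates

/-! ### Local quasi-isometries: local and compact lower bounds -/

section LocalBounds

variable {X Y : Type*} [MetricSpace X] [MetricSpace Y] {f : X → Y}

theorem lowerScalarDeriv_restrict {V : Set X} {W : Set Y} (h : MapsTo f V W) (hV : IsOpen V)
    (x : V) : lowerScalarDeriv (h.restrict f V W) x = lowerScalarDeriv f x := by
  have hmap : map ((↑) : V → X) (𝓝[≠] x) = 𝓝[≠] (x : X) := by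
    rw [← hV.isOpenEmbedding_subtypeVal.map_nhdsWithin_preimage_eq]
    congr 2
    ext z
    simp [Subtype.ext_iff]
  unfold lowerScalarDeriv
  rw [← hmap]
  rfl

theorem IsLocalDiniQuasiIsometry.isLocalHomeomorph (hf : IsLocalDiniQuasiIsometry f) :
    IsLocalHomeomorph f := by
  rw [isLocalHomeomorph_iff_isOpenEmbedding_restrict]
  intro x
  obtain ⟨V, W, h, hV, hx, hW, -, hq⟩ := hf x
  exact ⟨V, hV.mem_nhds hx, hW.isOpenEmbedding_subtypeVal.comp hq.1.isOpenEmbedding⟩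

theorem IsLocalDiniQuasiIsometry.eventually_le_lowerScalarDeriv
    (hf : IsLocalDiniQuasiIsometry f) (x : X) :
    ∃ α : ℝ, 0 < α ∧ ∀ᶠ z in 𝓝 x, ENNReal.ofReal α ≤ lowerScalarDeriv f z := by
  obtain ⟨V, W, h, hV, hx, -, -, -, α, -, hα, -, hle, -⟩ := hf x
  refine ⟨α, hα, ?_⟩
  filter_upwards [hV.mem_nhds hx] with z hz
  exact (le_iInf_iff.1 hle ⟨z, hz⟩).trans_eq (lowerScalarDeriv_restrict h hV ⟨z, hz⟩)

theorem IsLocalDiniQuasiIsometry.exists_le_lowerScalarDeriv_of_isCompact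
    (hf : IsLocalDiniQuasiIsometry f) {K : Set X} (hK : IsCompact K) :
    ∃ α : ℝ, 0 < α ∧ ∀ x ∈ K, ENNReal.ofReal α ≤ lowerScalarDeriv f x := by
  refine hK.induction_on (p := fun s => ∃ α : ℝ, 0 < α ∧ ∀ x ∈ s,
    ENNReal.ofReal α ≤ lowerScalarDeriv f x) ⟨1, one_pos, by simp⟩ ?_ ?_ ?_
  · rintro s t hst ⟨α, hα, h⟩
    exact ⟨α, hα, fun x hx => h x (hst hx)⟩
  · rintro s t ⟨α, hα, h⟩ ⟨β, hβ, h'⟩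
    refine ⟨min α β, lt_min hα hβ, ?_⟩
    rintro x (hx | hx)
    · exact (ENNReal.ofReal_le_ofReal (min_le_left _ _)).trans (h x hx)
    · exact (ENNReal.ofReal_le_ofReal (min_le_right _ _)).trans (h' x hx)
  · intro x _
    obtain ⟨α, hα, h⟩ := hf.eventually_le_lowerScalarDeriv x
    exact ⟨_, mem_nhdsWithin_of_mem_nhds h, α, hα, fun z hz => hz⟩

end LocalBounds

/-! ### Convergence of lifts through a covering -/

section Covering

variable {X Y : Type*} [MetricSpace X] [MetricSpace Y] {f : X → Y}

/-- If a path into the total space of a covering map has a convergent image path, then it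
converges. -/
theorem IsCoveringMap.exists_tendsto_of_comp (hf : IsCoveringMap f) {q : ℝ → X} {a b : ℝ} {y : Y}
    (hab : a < b) (hq : ContinuousOn q (Ico a b))
    (hy : Tendsto (f ∘ q) (𝓝[Ico a b] b) (𝓝 y)) :
    ∃ z, f z = y ∧ Tendsto q (𝓝[Ico a b] b) (𝓝 z) := by
  obtain ⟨hdisc, U, hyU, hU, -, H, hH⟩ := hf y
  have hev := hy.eventually (hU.mem_nhds hyU)
  rw [eventually_nhdsWithin_iff, Metric.eventually_nhds_iff] at hev
  obtain ⟨ε, hε, hev⟩ := hev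
  set m := max a (b - ε / 2) with hm
  have hma : a ≤ m := le_max_left _ _
  have hmb : m < b := max_lt hab (by linarith)
  have hsub : Ico m b ⊆ Ico a b := Ico_subset_Ico_left hma
  have hfU : ∀ t : Ico m b, f (q t) ∈ U := fun t => by
    refine hev ?_ (hsub t.2)
    have := (le_max_right a (b - ε / 2)).trans t.2.1
    rw [Real.dist_eq, abs_lt]; constructor <;> linarith [t.2.2]
  have hqc : Continuous fun t : Ico m b => (⟨q t, hfU t⟩ : f ⁻¹' U) :=
    (continuousOn_iff_continuous_domRestrict.1 (hq.mono hsub)).subtype_mk _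
  have : PreconnectedSpace (Ico m b) := isPreconnected_iff_preconnectedSpace.1 isPreconnected_Ico
  -- The fibre is discrete and `[m, b)` is connected, so the path stays in one sheet.
  have hconst : ∀ t : Ico m b, (H ⟨q t, hfU t⟩).2 = (H ⟨q m, hfU ⟨m, le_rfl, hmb⟩⟩).2 := fun t =>
    PreconnectedSpace.constant inferInstance
      (f := fun t : Ico m b => (H ⟨q t, hfU t⟩).2)
      (continuous_snd.comp (H.continuous.comp hqc)) (x := t) (y := ⟨m, le_rfl, hmb⟩)
  set i := (H ⟨q m, hfU ⟨m, le_rfl, hmb⟩⟩).2 with hi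
  refine ⟨H.symm (⟨y, hyU⟩, i), by rw [← hH]; simp, ?_⟩
  have hle : 𝓝[Ico m b] b = 𝓝[Ico a b] b := by
    have h1 : Ico m b = Ici m ∩ Ico a b := by
      ext t; simp only [mem_Ico, mem_inter_iff, mem_Ici]
      exact ⟨fun h => ⟨h.1, hma.trans h.1, h.2⟩, fun h => ⟨h.1, h.2.2⟩⟩
    rw [h1, inter_comm]
    exact nhdsWithin_inter_of_mem' (mem_nhdsWithin_of_mem_nhds (Ici_mem_nhds hmb))
  rw [← hle] at hy ⊢
  rw [nhdsWithin, ← map_comap_setCoe_val, tendsto_map'_iff] at hy ⊢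
  have hq_eq : q ∘ ((↑) : Ico m b → ℝ) =
      fun t : Ico m b => ((H.symm (⟨f (q t), hfU t⟩, i) : f ⁻¹' U) : X) := by
    ext t
    have : H ⟨q t, hfU t⟩ = (⟨f (q t), hfU t⟩, i) :=
      Prod.ext (Subtype.ext (hH _)) (hconst t)
    rw [← this, H.symm_apply_apply]
    rfl
  rw [hq_eq]
  refine ((continuous_subtype_val.comp H.symm.continuous).tendsto (⟨y, hyU⟩, i)).comp ?_
  exact (tendsto_subtype_rng.2 hy).prodMk_nhds tendsto_const_nhds

end Covering

/-! ### Path lifting, and the covering property from it -/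

section Lifting

variable {X Y : Type*} [MetricSpace X] [MetricSpace Y] {f : X → Y}

theorem exists_lift_extension {p : ℝ → Y} {q : ℝ → X} {s s' : ℝ} (e : OpenPartialHomeomorph X Y)
    (hs : 0 ≤ s) (hss' : s ≤ s') (hp : ContinuousOn p (Icc s s'))
    (hq : ContinuousOn q (Icc 0 s)) (hqp : ∀ t ∈ Icc 0 s, e (q t) = p t)
    (hsrc : q s ∈ e.source) (htgt : ∀ t ∈ Icc s s', p t ∈ e.target) :
    ∃ q' : ℝ → X, ContinuousOn q' (Icc 0 s') ∧ (∀ t ∈ Icc 0 s', e (q' t) = p t) ∧ q' 0 = q 0 := by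
  set q' : ℝ → X := fun t => if t ≤ s then q t else e.symm (p t) with hq'
  have h1 : EqOn q' q (Icc 0 s) := fun t ht => if_pos ht.2
  have h2 : EqOn q' (e.symm ∘ p) (Icc s s') := by
    intro t ht
    rcases ht.1.eq_or_lt with rfl | hlt
    · rw [h1 ⟨hs, le_rfl⟩, Function.comp_apply, ← hqp s ⟨hs, le_rfl⟩, e.left_inv hsrc]
    · exact if_neg (not_le.2 hlt)
  refine ⟨q', ?_, ?_, h1 ⟨le_rfl, hs⟩⟩
  · rw [← Icc_union_Icc_eq_Icc hs hss']
    exact (hq.congr h1).union_of_isClosed ((e.continuousOn_symm.comp hp htgt).congr h2)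
      isClosed_Icc isClosed_Icc
  · intro t ht
    rcases le_total t s with hts | hts
    · rw [h1 ⟨ht.1, hts⟩, hqp t ⟨ht.1, hts⟩]
    · rw [h2 ⟨hts, ht.2⟩, Function.comp_apply, e.right_inv (htgt t ⟨hts, ht.2⟩)]

theorem IsLocalHomeomorph.eqOn_lifts (hf : IsLocalHomeomorph f) {p : ℝ → Y} {q q' : ℝ → X} {s : ℝ}
    (hs : 0 ≤ s) (hq : ContinuousOn q (Icc 0 s)) (hq' : ContinuousOn q' (Icc 0 s))
    (hqp : ∀ t ∈ Icc 0 s, f (q t) = p t) (hqp' : ∀ t ∈ Icc 0 s, f (q' t) = p t)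
    (h0 : q 0 = q' 0) : EqOn q q' (Icc 0 s) :=
  (T2Space.isSeparatedMap f).eqOn_of_comp_eqOn hf.isLocallyInjective isPreconnected_Icc hq hq'
    (fun t ht => (hqp t ht).trans (hqp' t ht).symm) ⟨le_rfl, hs⟩ h0

/-- Let `T` be the supremum of the times up to which a lift exists. The continuation property gives
a limit point over `p T`; a lift that enters a chart around it shortly before `T` can be continued
past `T` by the local inverse. -/
theorem exists_lift_of_hasContinuationProperty (hf : IsLocalHomeomorph f) {p : ℝ → Y}
    (hp : ContinuousOn p (Icc 0 1)) (hc : HasContinuationProperty f p) {x : X} (hx : f x = p 0) :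
    ∃ q : ℝ → X, ContinuousOn q (Icc 0 1) ∧ (∀ t ∈ Icc (0 : ℝ) 1, f (q t) = p t) ∧ q 0 = x := by
  set S : Set ℝ := {s | s ∈ Icc (0 : ℝ) 1 ∧ ∃ q : ℝ → X, ContinuousOn q (Icc 0 s) ∧
    (∀ t ∈ Icc 0 s, f (q t) = p t) ∧ q 0 = x} with hS
  have h0 : (0 : ℝ) ∈ S := by
    refine ⟨⟨le_rfl, zero_le_one⟩, fun _ => x, continuousOn_const, fun t ht => ?_, rfl⟩
    rw [Icc_self, mem_singleton_iff] at ht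
    rw [hx, ht]
  have hbdd : BddAbove S := ⟨1, fun t ht => ht.1.2⟩
  set T := sSup S with hT
  have hT01 : T ∈ Icc (0 : ℝ) 1 := ⟨le_csSup hbdd h0, csSup_le ⟨0, h0⟩ fun t ht => ht.1.2⟩
  -- near the supremum, lifts can be continued through a chart around a limit point of the lift
  obtain ⟨z, hz, hclose⟩ : ∃ z, f z = p T ∧ ∀ V ∈ 𝓝 z, ∀ δ > 0, ∃ s ∈ S, T - δ < s ∧
      ∃ q : ℝ → X, ContinuousOn q (Icc 0 s) ∧ (∀ t ∈ Icc 0 s, f (q t) = p t) ∧ q 0 = x ∧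
        q s ∈ V := by
    rcases hT01.1.eq_or_lt with hT0 | hTpos
    · refine ⟨x, hT0 ▸ hx, fun V hV δ hδ => ⟨0, h0, by linarith, fun _ => x, continuousOn_const,
        fun t ht => ?_, rfl, mem_of_mem_nhds hV⟩⟩
      rw [Icc_self, mem_singleton_iff] at ht
      rw [hx, ht]
    · have hlift : ∀ s ∈ Ico 0 T, s ∈ S := by
        intro s hs
        obtain ⟨s', hs', hss'⟩ := exists_lt_of_lt_csSup ⟨0, h0⟩ hs.2
        obtain ⟨q, hq, hqp, hq0⟩ := hs'.2
        have hsub : Icc 0 s ⊆ Icc 0 s' := Icc_subset_Icc_right hss'.le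
        exact ⟨⟨hs.1, hs.2.le.trans hT01.2⟩, q, hq.mono hsub, fun t ht => hqp t (hsub ht), hq0⟩
      have : Nonempty X := ⟨x⟩
      choose! q hq hqp hq0 using fun s hs => (hlift s hs).2
      -- Lifts chosen for different times agree by uniqueness, so the diagonal glues them into one
      -- lift on `[0, T)`.
      have hcompat : ∀ s ∈ Ico 0 T, EqOn (fun t => q t t) (q s) (Icc 0 s) := by
        intro s hs t ht
        have htT : t ∈ Ico 0 T := ⟨ht.1, ht.2.trans_lt hs.2⟩
        have hsub : Icc 0 t ⊆ Icc 0 s := Icc_subset_Icc_right ht.2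
        exact hf.eqOn_lifts ht.1 (hq t htT) ((hq s hs).mono hsub) (hqp t htT)
          (fun u hu => hqp s hs u (hsub hu)) ((hq0 t htT).trans (hq0 s hs).symm) ⟨ht.1, le_rfl⟩
      have hpart : IsPartialLift f p T fun t => q t t := by
        refine ⟨fun t ht => ?_, fun t ht => hqp t ht t ⟨ht.1, le_rfl⟩⟩
        obtain ⟨s, hts, hsT⟩ := exists_between ht.2
        have hs : s ∈ Ico 0 T := ⟨ht.1.trans hts.le, hsT⟩
        have hmem : Icc 0 s ∈ 𝓝[Ico 0 T] t := by
          filter_upwards [self_mem_nhdsWithin, mem_nhdsWithin_of_mem_nhds (Iic_mem_nhds hts)]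
            with u hu hus using ⟨hu.1, hus⟩
        exact (((hq s hs).congr (hcompat s hs)) t ⟨ht.1, hts.le⟩).mono_of_mem_nhdsWithin hmem
      obtain ⟨t, ht, htT, z, hz⟩ := hc T ⟨hTpos, hT01.2⟩ _ hpart
      refine ⟨z, ?_, fun V hV δ hδ => ?_⟩
      · have h1 := (hf.continuous.tendsto z).comp hz
        have h2 : Tendsto (fun n => p (t n)) atTop (𝓝 (p T)) :=
          (hp T hT01).tendsto.comp (tendsto_nhdsWithin_iff.2 ⟨htT, Eventually.of_forall fun n =>
            ⟨(ht n).1, (ht n).2.le.trans hT01.2⟩⟩)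
        refine tendsto_nhds_unique h1 (h2.congr fun n => ?_)
        exact (hpart.2 (t n) (ht n)).symm
      · obtain ⟨n, hn, hn'⟩ := ((hz.eventually_mem hV).and
          (htT.eventually (lt_mem_nhds (sub_lt_self T hδ)))).exists
        exact ⟨t n, hlift _ (ht n), hn', q (t n), hq _ (ht n), hqp _ (ht n), hq0 _ (ht n), hn⟩
  obtain ⟨e, hze, rfl⟩ := hf z
  have hev := (hp T hT01).eventually_mem (e.open_target.mem_nhds (hz ▸ e.map_source hze))
  rw [eventually_nhdsWithin_iff, Metric.eventually_nhds_iff] at hev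
  obtain ⟨δ, hδ, hev⟩ := hev
  obtain ⟨s, hsS, hs, q, hq, hqp, hq0, hqs⟩ := hclose _ (e.open_source.mem_nhds hze) δ hδ
  have hsT : s ≤ T := le_csSup hbdd hsS
  have hm1 := min_le_left (T + δ / 2) 1
  have hm2 := min_le_right (T + δ / 2) 1
  have hTm : T ≤ min (T + δ / 2) 1 := le_min (by linarith) hT01.2
  have hsub : Icc s (min (T + δ / 2) 1) ⊆ Icc 0 1 := Icc_subset_Icc hsS.1.1 hm2
  obtain ⟨q', hq', hqp', hq0'⟩ := exists_lift_extension e hsS.1.1 (hsT.trans hTm) (hp.mono hsub)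
    hq hqp hqs fun t ht => by
      refine hev ?_ (hsub ht)
      rw [Real.dist_eq, abs_lt]; constructor <;> linarith [ht.1, ht.2]
  have hmS : min (T + δ / 2) 1 ∈ S := ⟨⟨hT01.1.trans hTm, hm2⟩, q', hq', hqp', hq0'.trans hq0⟩
  have hmT := le_csSup hbdd hmS
  -- Otherwise `T + δ / 2` would lie in `S`, beyond its supremum.
  have h1 : min (T + δ / 2) 1 = 1 := by
    rcases min_choice (T + δ / 2) 1 with h | h
    · rw [h] at hmT; linarith
    · exact h
  rw [h1] at hq' hqp'
  exact ⟨q', hq', hqp', hq0'.trans hq0⟩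

theorem IsRectifiablePath.reverse {p : ℝ → Y} (hp : IsRectifiablePath p) :
    IsRectifiablePath fun t => p (1 - t) := by
  have himg : (fun t : ℝ => 1 - t) '' Icc 0 1 = Icc 0 1 := by simp
  refine ⟨hp.1.comp (by fun_prop) (mapsTo_iff_image_subset.2 himg.subset), ?_⟩
  have h := eVariationOn.comp_eq_of_antitoneOn p (t := Icc 0 1) (fun t : ℝ => 1 - t)
    (fun s _ t _ hst => sub_le_sub_left hst 1)
  rw [himg] at h
  exact h.trans_lt hp.2

/-- Every rectifiable path in `Y` lifts to `X`, with any prescribed initial point. -/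
def LiftsRectifiablePaths (f : X → Y) : Prop :=
  ∀ p : ℝ → Y, IsRectifiablePath p → ∀ x, f x = p 0 →
    ∃ Γ : C(I, X), Γ 0 = x ∧ ∀ t : I, f (Γ t) = p t

theorem liftsRectifiablePaths_of_hasContinuationProperty (hf : IsLocalHomeomorph f)
    (hc : ∀ p : ℝ → Y, IsRectifiablePath p → HasContinuationProperty f p) :
    LiftsRectifiablePaths f := by
  intro p hp x hx
  obtain ⟨q, hq, hqp, hq0⟩ := exists_lift_of_hasContinuationProperty hf hp.1 (hc p hp) hx
  exact ⟨⟨fun t => q t, continuousOn_iff_continuous_domRestrict.1 hq⟩, hq0, fun t => hqp t t.2⟩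

/-- The range is open. It is closed because a contractible neighbourhood of a limit point `y₀` meets
it, and the lift of the contracting path run backwards ends over `y₀`. -/
theorem LiftsRectifiablePaths.surjective [Nonempty X] [PreconnectedSpace Y]
    (hY : IsLocallyRectifiablyContractible Y) (hf : IsLocalHomeomorph f)
    (hl : LiftsRectifiablePaths f) : Function.Surjective f := by
  rw [← range_eq_univ]
  refine IsClopen.eq_univ ⟨?_, hf.isOpenMap.isOpen_range⟩ (range_nonempty f)
  rw [← closure_subset_iff_isClosed]
  intro y₀ hy₀
  obtain ⟨U, hU, hyU, H, -, -, -, h01, hrect⟩ := hY y₀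
  obtain ⟨_, hyU', x, rfl⟩ := mem_closure_iff.1 hy₀ U hU hyU
  obtain ⟨Γ, -, hΓ⟩ := hl _ (hrect _ hyU').reverse x (by simp [(h01 _ hyU').2])
  refine ⟨Γ 1, ?_⟩
  rw [hΓ]
  simp [(h01 _ hyU').1]

theorem LiftsRectifiablePaths.isCoveringMap
    (hY : IsLocallyRectifiablyContractible Y) (hf : IsLocalHomeomorph f)
    (hl : LiftsRectifiablePaths f) : IsCoveringMap f := by
  intro y₀
  obtain ⟨U, hU, hyU, H, hHc, -, -, h01, hrect⟩ := hY y₀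
  have hsep : IsSeparatedMap f := T2Space.isSeparatedMap f
  -- A local homeomorphism reflects discreteness, and the fibre maps to at most one point.
  have hdisc : DiscreteTopology (f ⁻¹' {y₀}) := by
    have : DiscreteTopology (f '' (f ⁻¹' {y₀})) :=
      by
      have : Subsingleton (f '' (f ⁻¹' {y₀})) :=
        (subsingleton_singleton.anti (image_preimage_subset f {y₀})).coe_sort
      infer_instance
    exact hf.isLocalHomeomorphOn.discreteTopology_of_image
  have hHc' : Continuous fun z : U × I => H (z.1, z.2) :=
    hHc.comp_continuous (by fun_prop) fun z => ⟨z.1.2, z.2.2⟩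
  -- lifts of the contracting paths starting in `f ⁻¹' U`, and of their reverses
  choose G hG0 hG using fun z : f ⁻¹' U => hl _ (hrect _ z.2).reverse z (by simp [(h01 _ z.2).2])
  choose G' hG0' hG' using fun z : U × f ⁻¹' {y₀} => hl _ (hrect _ z.1.2) z.2
    (by rw [(h01 _ z.1.2).1]; exact z.2.2)
  -- Lifts chosen pointwise are jointly continuous: they lift a homotopy, with continuous initial
  -- values, through a separated local homeomorphism.
  have hGc : Continuous fun w : I × f ⁻¹' U => G w.2 w.1 := by
    refine hf.continuous_lift hsep ⟨fun w : I × f ⁻¹' U => H (f w.2, 1 - w.1), ?_⟩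
      (funext fun w => hG w.2 w.1) ?_ fun z => (G z).continuous
    · exact hHc'.comp (f := fun w : I × f ⁻¹' U => ((⟨f w.2, w.2.2⟩ : U), unitInterval.symm w.1))
        (((hf.continuous.comp (by fun_prop)).subtype_mk _).prodMk (by fun_prop))
    · simp only [hG0]; exact continuous_subtype_val
  have hGc' : Continuous fun w : I × (U × f ⁻¹' {y₀}) => G' w.2 w.1 := by
    refine hf.continuous_lift hsep ⟨fun w : I × (U × f ⁻¹' {y₀}) => H (w.2.1, w.1), ?_⟩
      (funext fun w => hG' w.2 w.1) ?_ fun z => (G' z).continuous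
    · exact hHc'.comp (f := fun w : I × (U × f ⁻¹' {y₀}) => (w.2.1, w.1)) (by fun_prop)
    · simp only [hG0']; fun_prop
  have hφ : ∀ z : f ⁻¹' U, f (G z 1) = y₀ := fun z => by
    rw [hG]; simpa using (h01 _ z.2).1
  have hψ : ∀ w : U × f ⁻¹' {y₀}, f (G' w 1) = w.1 := fun w => by
    rw [hG']; simpa using (h01 _ w.1.2).2
  refine ⟨hdisc, U, hyU, hU, hU.preimage hf.continuous,
    { toFun := fun z => (⟨f z, z.2⟩, ⟨G z 1, hφ z⟩)
      invFun := fun w => ⟨G' w 1, by rw [mem_preimage, hψ]; exact w.1.2⟩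
      left_inv := fun z => ?_
      right_inv := fun w => ?_
      continuous_toFun := ?_
      continuous_invFun := ?_ }, fun z => rfl⟩
  -- By uniqueness, the lift that starts at the end of `G z` retraces `G z` backwards, so it ends at
  -- `z`.
  · have h := hsep.eq_of_comp_eq hf.isLocallyInjective
      (g₁ := fun t : I => G' (⟨f z, z.2⟩, ⟨G z 1, hφ z⟩) t)
      (g₂ := fun t : I => G z (unitInterval.symm t)) (by fun_prop) (by fun_prop)
      (funext fun t => by simp [hG, hG']) 0 (by simp [hG0'])
    refine Subtype.ext ((congrFun h 1).trans ?_)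
    simp [hG0]
  · have h := hsep.eq_of_comp_eq hf.isLocallyInjective
      (g₁ := fun t : I => G ⟨G' w 1, by rw [mem_preimage, hψ]; exact w.1.2⟩ t)
      (g₂ := fun t : I => G' w (unitInterval.symm t)) (by fun_prop) (by fun_prop)
      (funext fun t => by rw [Function.comp_apply, Function.comp_apply, hG, hψ, hG']; rfl) 0 (by simp [hG0])
    refine Prod.ext (Subtype.ext (hψ w)) (Subtype.ext ((congrFun h 1).trans ?_))
    simp [hG0']
  · exact ((hf.continuous.comp continuous_subtype_val).subtype_mk _).prodMk
      ((hGc.comp (by fun_prop : Continuous fun z : f ⁻¹' U => ((1 : I), z))).subtype_mk _)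
  · exact (hGc'.comp (by fun_prop : Continuous fun w : U × f ⁻¹' {y₀} => ((1 : I), w))).subtype_mk _

end Lifting

/-! ### Injectivity of coverings from fundamental groups -/

section Injectivity

variable {X Y : Type*} [TopologicalSpace X] [TopologicalSpace Y] {f : X → Y}

/-- A covering map with path-connected total space is injective as soon as it is surjective on
fundamental groups. -/
theorem IsCoveringMap.injective_of_surjective_fundamentalGroup_map [PathConnectedSpace X]
    (hf : IsCoveringMap f)
    (h : ∀ x, Function.Surjective (FundamentalGroup.map ⟨f, hf.continuous⟩ x)) :
    Function.Injective f := by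
  intro x x' hxx'
  let γ : Path.Homotopic.Quotient x x' := .mk (PathConnectedSpace.somePath x x')
  obtain ⟨δ, hδ⟩ := h x ((γ.map ⟨f, hf.continuous⟩).cast rfl hxx')
  -- The image of `γ` is a loop class at `f x`. Its monodromy sends `x` to `x'` along the lift `γ`,
  -- and to `x` along the loop `δ`.
  have h1 := hf.monodromy_eq_of_map_eq (ex := ⟨x, rfl⟩) (ey := ⟨x', hxx'.symm⟩)
    (γ := (γ.map ⟨f, hf.continuous⟩).cast rfl hxx') γ
    (eq_of_heq (((Path.Homotopic.Quotient.cast_heq ..).trans (Path.Homotopic.Quotient.cast_heq ..)).symm))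
  have h2 := hf.monodromy_eq_of_map_eq (ex := ⟨x, rfl⟩) (ey := ⟨x, rfl⟩)
    (γ := (γ.map ⟨f, hf.continuous⟩).cast rfl hxx') δ
    (by rw [← hδ]; exact eq_of_heq (Path.Homotopic.Quotient.cast_heq ..).symm)
  exact congrArg Subtype.val (h2.symm.trans h1)

theorem IsCoveringMap.injective_fundamentalGroup_map (hf : IsCoveringMap f) (x : X) :
    Function.Injective (FundamentalGroup.map ⟨f, hf.continuous⟩ x) :=
  hf.injective_path_homotopic_map x x

/-- In the finite case `f_*`, injective for any covering, becomes after the isomorphism an injective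
self-map of a finite set, hence surjective. Path-connectedness moves the isomorphism to the required
base points. -/
theorem IsCoveringMap.injective_of_fundamentalGroup [PathConnectedSpace X] [PathConnectedSpace Y]
    (hf : IsCoveringMap f)
    (h : SimplyConnectedSpace Y ∨ ∃ (x : X) (y : Y), Finite (FundamentalGroup Y y) ∧
      Nonempty (FundamentalGroup X x ≃* FundamentalGroup Y y)) :
    Function.Injective f := by
  refine hf.injective_of_surjective_fundamentalGroup_map fun x => ?_
  rcases h with h | ⟨x₁, y₁, hfin, ⟨e⟩⟩
  · have : Subsingleton (FundamentalGroup Y (f x)) :=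
      inferInstanceAs (Subsingleton (Path.Homotopic.Quotient (f x) (f x)))
    exact Function.surjective_to_subsingleton _
  · let e' : FundamentalGroup X x ≃* FundamentalGroup Y (f x) :=
      (FundamentalGroup.fundamentalGroupMulEquivOfPathConnected x x₁).trans
        (e.trans (FundamentalGroup.fundamentalGroupMulEquivOfPathConnected y₁ (f x)))
    have : Finite (FundamentalGroup Y (f x)) := Finite.of_equiv _
      (FundamentalGroup.fundamentalGroupMulEquivOfPathConnected y₁ (f x)).toEquiv
    have hinj : Function.Injective (e'.symm ∘ FundamentalGroup.map ⟨f, hf.continuous⟩ x) :=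
      e'.symm.injective.comp (hf.injective_fundamentalGroup_map x)
    have : Finite (FundamentalGroup X x) := Finite.of_equiv _ e'.symm.toEquiv
    exact (Function.Surjective.of_comp_iff' e'.symm.bijective _).1
      (Finite.surjective_of_injective hinj)

end Injectivity

/-! ### The individual implications -/

section Equivalences

variable {X Y : Type*} [MetricSpace X] [MetricSpace Y] {f : X → Y}

theorem IsPartialLift.eVariationOn_comp_lt_top {p : ℝ → Y} {b : ℝ} {q : ℝ → X}
    (hq : IsPartialLift f p b q) (hb : b ≤ 1) (hp : IsRectifiablePath p) :
    eVariationOn (f ∘ q) (Ico 0 b) < ∞ := by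
  rw [eVariationOn.congr (f := f ∘ q) (g := p) fun t ht => hq.2 t ht]
  exact (eVariationOn.mono p (Ico_subset_Icc_self.trans (Icc_subset_Icc_right hb))).trans_lt hp.2

theorem exists_seq_tendsto_of_eVariationOn_lt_top [CompleteSpace X] {q : ℝ → X} {b : ℝ}
    (hb : 0 < b) (h : eVariationOn q (Ico 0 b) < ∞) :
    ∃ t : ℕ → ℝ, (∀ n, t n ∈ Ico 0 b) ∧ Tendsto t atTop (𝓝 b) ∧
      ∃ z : X, Tendsto (fun n => q (t n)) atTop (𝓝 z) := by
  obtain ⟨z, hz⟩ := exists_tendsto_of_eVariationOn_lt_top h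
  have hcl : b ∈ closure (Ico 0 b) := by
    rw [closure_Ico hb.ne]; exact ⟨hb.le, le_rfl⟩
  obtain ⟨t, ht, htb⟩ := mem_closure_iff_seq_limit.1 hcl
  exact ⟨t, ht, htb, z, hz.comp (tendsto_nhdsWithin_iff.2 ⟨htb, Eventually.of_forall ht⟩)⟩

/-- Along a convergent path, the lower scalar derivative of a local quasi-isometry is bounded
below. -/
theorem IsLocalDiniQuasiIsometry.exists_le_lowerScalarDeriv_of_tendsto
    (hf : IsLocalDiniQuasiIsometry f) {q : ℝ → X} {a b : ℝ} {z : X}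
    (hq : ContinuousOn q (Ico a b)) (hz : Tendsto q (𝓝[Ico a b] b) (𝓝 z)) :
    ∃ α : ℝ, 0 < α ∧ ∀ t ∈ Ico a b, ENNReal.ofReal α ≤ lowerScalarDeriv f (q t) := by
  classical
  -- Adding the limit as endpoint extends the path to the compact interval `[a, b]`.
  set q' := Function.update q b z with hq'
  have heq : EqOn q' q (Ico a b) := fun t ht => Function.update_of_ne ht.2.ne _ _
  have hcont : ContinuousOn q' (Icc a b) := by
    have h := continuousOn_update_iff.2 (show ContinuousOn q (Icc a b \ {b}) ∧
      (b ∈ Icc a b → Tendsto q (𝓝[Icc a b \ {b}] b) (𝓝 z)) by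
        rw [Icc_sdiff_right]; exact ⟨hq, fun _ => hz⟩)
    exact h
  obtain ⟨α, hα, h⟩ := hf.exists_le_lowerScalarDeriv_of_isCompact 
    (isCompact_Icc.image_of_continuousOn hcont)
  exact ⟨α, hα, fun t ht => heq ht ▸ h _ (mem_image_of_mem _ (Ico_subset_Icc_self ht))⟩

theorem IsCoveringMap.liftsFiniteLength [CompleteSpace Y] (hf : IsLocalDiniQuasiIsometry f)
    (hc : IsCoveringMap f) : LiftsFiniteLength f := by
  intro a b q hab hq hfin
  rw [pathLengthIco_eq_eVariationOn] at hfin ⊢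
  -- Completeness of `Y` provides the missing endpoint of the image path.
  obtain ⟨y, hy⟩ := exists_tendsto_of_eVariationOn_lt_top hfin
  obtain ⟨z, -, hz⟩ := hc.exists_tendsto_of_comp hab hq hy
  obtain ⟨α, hα, h⟩ := hf.exists_le_lowerScalarDeriv_of_tendsto hq hz
  exact eVariationOn_lt_top_of_lowerScalarDeriv_bound hα hq h hfin

theorem IsCoveringMap.hasBoundedPathLifting (hf : IsLocalDiniQuasiIsometry f)
    (hc : IsCoveringMap f) {p : ℝ → Y} (hp : IsRectifiablePath p) : HasBoundedPathLifting f p := by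
  intro b hb q hq
  have hlim : Tendsto (f ∘ q) (𝓝[Ico 0 b] b) (𝓝 (p b)) := by
    have h1 : Tendsto p (𝓝[Ico 0 b] b) (𝓝 (p b)) := (hp.1 b ⟨hb.1.le, hb.2⟩).mono_left
      (nhdsWithin_mono _ (Ico_subset_Icc_self.trans (Icc_subset_Icc_right hb.2)))
    exact h1.congr' (eventually_nhdsWithin_of_forall fun t ht => (hq.2 t ht).symm)
  obtain ⟨z, -, hz⟩ := hc.exists_tendsto_of_comp hb.1 hq.1 hlim
  obtain ⟨α, hα, h⟩ := hf.exists_le_lowerScalarDeriv_of_tendsto hq.1 hz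
  exact ⟨α, hα, le_iInf₂ (by rintro _ ⟨t, ht, rfl⟩; exact h t ht)⟩

theorem HasBoundedPathLifting.hasWeightedBoundedPathLifting [Nonempty X] {p : ℝ → Y}
    (h : HasBoundedPathLifting f p) : HasWeightedBoundedPathLifting f p fun _ => 1 := by
  intro b hb q hq
  obtain ⟨α, hα, hle⟩ := h b hb q hq
  exact ⟨Classical.arbitrary X, α, hα, by simpa using hle⟩

theorem HasWeightedBoundedPathLifting.hasContinuationProperty [CompleteSpace X] {p : ℝ → Y}
    {ω : ℝ → ℝ} (hω : IsWeight ω) (hp : IsRectifiablePath p)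
    (h : HasWeightedBoundedPathLifting f p ω) : HasContinuationProperty f p := by
  intro b hb q hq
  obtain ⟨x₀, α, hα, hle⟩ := h b hb q hq
  exact exists_seq_tendsto_of_eVariationOn_lt_top hb.1 (eVariationOn_lt_top_of_isWeight hω hα hq.1
    (fun t ht => (le_iInf₂_iff.1 hle) (q t) (mem_image_of_mem q ht))
    (hq.eVariationOn_comp_lt_top hb.2 hp))

theorem LiftsFiniteLength.hasContinuationProperty [CompleteSpace X] (h : LiftsFiniteLength f)
    {p : ℝ → Y} (hp : IsRectifiablePath p) : HasContinuationProperty f p := by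
  intro b hb q hq
  refine exists_seq_tendsto_of_eVariationOn_lt_top hb.1 ?_
  rw [← pathLengthIco_eq_eVariationOn]
  refine h 0 b q hb.1 hq.1 ?_
  rw [pathLengthIco_eq_eVariationOn]
  exact hq.eVariationOn_comp_lt_top hb.2 hp

theorem isCoveringProjection_of_hasContinuationProperty [Nonempty X] [PreconnectedSpace Y]
    (hY : IsLocallyRectifiablyContractible Y) (hf : IsLocalHomeomorph f)
    (hc : ∀ p : ℝ → Y, IsRectifiablePath p → HasContinuationProperty f p) :
    IsCoveringProjection f :=
  have hl := liftsRectifiablePaths_of_hasContinuationProperty hf hc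
  ⟨hl.isCoveringMap hY hf, hl.surjective hY hf⟩

theorem IsHomeomorph.isCompactProper (hf : IsHomeomorph f) : IsCompactProper f :=
  ⟨hf.continuous, fun _ hK => (hf.homeomorph f).isCompact_preimage.2 hK⟩

theorem IsCompactProper.lowerBoundedOverCompacts (hf : IsLocalDiniQuasiIsometry f)
    (hp : IsCompactProper f) : LowerBoundedOverCompacts f := fun K hK =>
  hf.exists_le_lowerScalarDeriv_of_isCompact (hp.2 K hK)

theorem LowerBoundedOverCompacts.hasBoundedPathLifting (h : LowerBoundedOverCompacts f)
    {p : ℝ → Y} (hp : IsRectifiablePath p) : HasBoundedPathLifting f p := by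
  intro b hb q hq
  obtain ⟨α, hα, hle⟩ := h _ (isCompact_Icc.image_of_continuousOn hp.1)
  refine ⟨α, hα, le_iInf₂ ?_⟩
  rintro _ ⟨t, ht, rfl⟩
  refine hle _ ?_
  rw [mem_preimage, hq.2 t ht]
  exact mem_image_of_mem p ⟨ht.1, ht.2.le.trans hb.2⟩

end Equivalences

theorem mainTheorem2 {X Y : Type*} [MetricSpace X] [MetricSpace Y] [CompleteSpace X]
    [CompleteSpace Y] [Nonempty X] [PathConnectedSpace Y]
    (hY : IsLocallyRectifiablyContractible Y)
    (f : X → Y) (hf : IsLocalDiniQuasiIsometry f) :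
    List.TFAE [
      IsCoveringProjection f,
      ∀ p : ℝ → Y, IsRectifiablePath p → HasContinuationProperty f p,
      LiftsFiniteLength f,
      ∀ p : ℝ → Y, IsRectifiablePath p → HasBoundedPathLifting f p,
      ∃ ω : ℝ → ℝ, IsWeight ω ∧
        ∀ p : ℝ → Y, IsRectifiablePath p → HasWeightedBoundedPathLifting f p ω] ∧
    (PathConnectedSpace X →
      (SimplyConnectedSpace Y ∨ ∃ (x : X) (y : Y), Finite (FundamentalGroup Y y) ∧
        Nonempty (FundamentalGroup X x ≃* FundamentalGroup Y y)) →
      List.TFAE [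
        IsCoveringProjection f,
        ∀ p : ℝ → Y, IsRectifiablePath p → HasContinuationProperty f p,
        LiftsFiniteLength f,
        ∀ p : ℝ → Y, IsRectifiablePath p → HasBoundedPathLifting f p,
        ∃ ω : ℝ → ℝ, IsWeight ω ∧
          ∀ p : ℝ → Y, IsRectifiablePath p → HasWeightedBoundedPathLifting f p ω,
        IsHomeomorph f,
        IsCompactProper f,
        LowerBoundedOverCompacts f]) := by
  have hloc := hf.isLocalHomeomorph
  have h14 : IsCoveringProjection f →
      ∀ p : ℝ → Y, IsRectifiablePath p → HasBoundedPathLifting f p :=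
    fun h _ hp => h.1.hasBoundedPathLifting hf hp
  have h45 : (∀ p : ℝ → Y, IsRectifiablePath p → HasBoundedPathLifting f p) →
      ∃ ω : ℝ → ℝ, IsWeight ω ∧
        ∀ p : ℝ → Y, IsRectifiablePath p → HasWeightedBoundedPathLifting f p ω :=
    fun h => ⟨_, isWeight_one, fun p hp => (h p hp).hasWeightedBoundedPathLifting⟩
  have h52 : (∃ ω : ℝ → ℝ, IsWeight ω ∧
        ∀ p : ℝ → Y, IsRectifiablePath p → HasWeightedBoundedPathLifting f p ω) →
      ∀ p : ℝ → Y, IsRectifiablePath p → HasContinuationProperty f p :=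
    fun ⟨_, hω, h⟩ p hp => (h p hp).hasContinuationProperty hω hp
  have h13 : IsCoveringProjection f → LiftsFiniteLength f := fun h => h.1.liftsFiniteLength hf
  have h32 : LiftsFiniteLength f →
      ∀ p : ℝ → Y, IsRectifiablePath p → HasContinuationProperty f p :=
    fun h _ hp => h.hasContinuationProperty hp
  have h21 : (∀ p : ℝ → Y, IsRectifiablePath p → HasContinuationProperty f p) →
      IsCoveringProjection f := isCoveringProjection_of_hasContinuationProperty hY hloc
  refine ⟨?_, fun hX hπ => ?_⟩
  · tfae_have 1 → 4 := h14
    tfae_have 4 → 5 := h45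
    tfae_have 5 → 2 := h52
    tfae_have 1 → 3 := h13
    tfae_have 3 → 2 := h32
    tfae_have 2 → 1 := h21
    tfae_finish
  · tfae_have 1 → 4 := h14
    tfae_have 4 → 5 := h45
    tfae_have 5 → 2 := h52
    tfae_have 1 → 3 := h13
    tfae_have 3 → 2 := h32
    tfae_have 2 → 1 := h21
    tfae_have 1 → 6 := fun h =>
      ⟨hloc.continuous, hloc.isOpenMap, h.1.injective_of_fundamentalGroup hπ, h.2⟩
    tfae_have 6 → 7 := IsHomeomorph.isCompactProper
    tfae_have 7 → 8 := IsCompactProper.lowerBoundedOverCompacts hf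
    tfae_have 8 → 4 := fun h _ hp => h.hasBoundedPathLifting hp
    tfae_finish
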